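/- Let $\mathcal{A}$ be a Desargues affine plane: a set $\mathcal P$ of points with a family of subsets called lines such that (i) two distinct points lie on exactly one line, (ii) for each line $\ell$ and each point $P\notin\ell$ there is exactly one line through $P$ disjoint from $\ell$, (iii) there are three non-collinear points, and (iv) Desargues' axiom holds: if $A\ne A'$, $B\neq B'$, $C\neq C'$, the points $A,B,C$ are pairwise distinct, the points $A',B',C'$ are pairwise distinct, the lines $AA'$, $BB'$, $CC'$ are pairwise distinct and either parallel or all through one point, and $AB\parallel A'B'$, $BC\parallel B'C'$, then $AC\parallel A'C'$ (two lines are parallel if they are equal or disjoint). Write $\ell^{PQ}$ for the line through $P\ne Q$, and $\ell^{P}_{QR}$ for the line through $P$ parallel to $\ell^{QR}$. Fix two distinct points $O,I$. For $A,B\in\ell^{OI}$ the points $A+B$ and $A\cdot B$ of $\ell^{OI}$ are constructed with an arbitrary auxiliary point $B_1\notin\ell^{OI}$ as follows: $$\ell_{OI}^{B_1}\cap\ell_{OB_1}^{A}=\{P_1\},\quad \ell_{BB_1}^{P_1}\cap\ell^{OI}=\{A+B\};\qquad \ell_{IB_1}^{A}\cap\ell^{OB_1}=\{Q_1\},\quad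 \ell_{BB_1}^{Q_1}\cap\ell^{OI}=\{A\cdot B\}.$$ Let $-A$ be the additive inverse (with respect to $O$), $A-B=A+(-B)$, and, for $A\neq O$, let $A^{-1}$ be the multiplicative inverse (with respect to $I$). Let $B,C,D\in\ell^{OI}$ with $B\ne C$. For $X\in\ell^{OI}$ with $X\neq D$ put $$\mu(X)=c_r(X,B;C,D)=\bigl[(X-D)^{-1}(B-D)\bigr]\bigl[(B-C)^{-1}(X-C)\bigr],$$ and let $\mathcal R_4^A=\{\mu(X) : X\in\ell^{OI},\ X\ne D\}$. Then for any three elements $\mu(X),\mu(Y),\mu(Z)$ of $\mathcal R_4^A$: 1. $\mu(X)\cdot[\mu(Y)+\mu(Z)]=\mu(X)\cdot\mu(Y)+\mu(X)\cdot\mu(Z)$; 2. $[\mu(X)+\mu(Y)]\cdot\mu(Z)=\mu(X)\cdot\mu(Z)+\mu(Y)\cdot\mu(Z)$. -/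

import Mathlib

/-- An affine plane with point set `P`; a line is a set of points. -/
structure AffinePlane (P : Type*) where
  /-- The set of lines. -/
  lines : Set (Set P)
  /-- Two distinct points lie on exactly one line. -/
  existsUnique_line : ∀ p q : P, p ≠ q → ∃! l : Set P, l ∈ lines ∧ p ∈ l ∧ q ∈ l
  /-- Playfair's axiom. -/
  playfair : ∀ (p : P), ∀ l ∈ lines, p ∉ l → ∃! m : Set P, m ∈ lines ∧ p ∈ m ∧ l ∩ m = ∅
  /-- There are three non-collinear points. -/
  exists_triangle : ∃ p q r : P, p ≠ q ∧ p ≠ r ∧ q ≠ r ∧ ¬ ∃ l ∈ lines, p ∈ l ∧ q ∈ l ∧ r ∈ l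

namespace AffinePlane

variable {P : Type*} (𝒜 : AffinePlane P)

/-- Two lines are parallel if they are equal or do not meet. -/
def Parallel (l m : Set P) : Prop := l = m ∨ l ∩ m = ∅

/-- The line through two distinct points (only meaningful for `p ≠ q`). -/
noncomputable def line (p q : P) : Set P :=
  Classical.epsilon fun l => l ∈ 𝒜.lines ∧ p ∈ l ∧ q ∈ l

/-- The line through the point `p` that is parallel to the line `l`
(only meaningful if `l` is a line). It is `l` itself when `p ∈ l`. -/
noncomputable def parallelThrough (p : P) (l : Set P) : Set P :=
  Classical.epsilon fun m => m ∈ 𝒜.lines ∧ p ∈ m ∧ Parallel m l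

/-- Desargues' axiom. The points `A, A'`, `B, B'`, `C, C'` lie on three distinct lines which are
parallel or pass through a common point. If `AB ∥ A'B'` and `BC ∥ B'C'`, then `AC ∥ A'C'`. -/
def IsDesarguesian : Prop :=
  ∀ A B C A' B' C' : P,
    A ≠ A' → B ≠ B' → C ≠ C' →
    A ≠ B → B ≠ C → A ≠ C → A' ≠ B' → B' ≠ C' → A' ≠ C' →
    𝒜.line A A' ≠ 𝒜.line B B' → 𝒜.line B B' ≠ 𝒜.line C C' → 𝒜.line A A' ≠ 𝒜.line C C' →
    ((Parallel (𝒜.line A A') (𝒜.line B B') ∧ Parallel (𝒜.line B B') (𝒜.line C C')) ∨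
      ∃ S : P, S ∈ 𝒜.line A A' ∧ S ∈ 𝒜.line B B' ∧ S ∈ 𝒜.line C C') →
    Parallel (𝒜.line A B) (𝒜.line A' B') →
    Parallel (𝒜.line B C) (𝒜.line B' C') →
    Parallel (𝒜.line A C) (𝒜.line A' C')

/-- `C` is a result of the addition algorithm for the points `A, B` of the line `OI`, for some
auxiliary point `B₁` off this line. -/
def IsSum (O I A B C : P) : Prop :=
  ∃ B₁ : P, B₁ ∉ 𝒜.line O I ∧ ∃ P₁ : P,
    𝒜.parallelThrough B₁ (𝒜.line O I) ∩ 𝒜.parallelThrough A (𝒜.line O B₁) = {P₁} ∧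
    𝒜.parallelThrough P₁ (𝒜.line B B₁) ∩ 𝒜.line O I = {C}

/-- `C` is a result of the multiplication algorithm for the points `A, B` of the line `OI`, for
some auxiliary point `B₁` off this line. -/
def IsProd (O I A B C : P) : Prop :=
  ∃ B₁ : P, B₁ ∉ 𝒜.line O I ∧ ∃ P₁ : P,
    𝒜.parallelThrough A (𝒜.line I B₁) ∩ 𝒜.line O B₁ = {P₁} ∧
    𝒜.parallelThrough P₁ (𝒜.line B B₁) ∩ 𝒜.line O I = {C}

/-! ### The two algorithms can always be carried out -/

theorem line_spec {p q : P} (h : p ≠ q) :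
    𝒜.line p q ∈ 𝒜.lines ∧ p ∈ 𝒜.line p q ∧ q ∈ 𝒜.line p q :=
  Classical.epsilon_spec (p := fun l => l ∈ 𝒜.lines ∧ p ∈ l ∧ q ∈ l)
    (𝒜.existsUnique_line p q h).exists

theorem parallelThrough_spec (p : P) {l : Set P} (hl : l ∈ 𝒜.lines) :
    𝒜.parallelThrough p l ∈ 𝒜.lines ∧ p ∈ 𝒜.parallelThrough p l ∧
      Parallel (𝒜.parallelThrough p l) l := by
  refine Classical.epsilon_spec (p := fun m => m ∈ 𝒜.lines ∧ p ∈ m ∧ Parallel m l) ?_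
  by_cases hp : p ∈ l
  · exact ⟨l, hl, hp, Or.inl rfl⟩
  · obtain ⟨m, hm, hpm, hlm⟩ := (𝒜.playfair p l hl hp).exists
    exact ⟨m, hm, hpm, Or.inr (by rw [Set.inter_comm]; exact hlm)⟩

theorem Parallel.symm {l m : Set P} (h : Parallel l m) : Parallel m l := by
  rcases h with h | h
  · exact Or.inl h.symm
  · exact Or.inr (by rw [Set.inter_comm]; exact h)

theorem Parallel.eq_of_mem {l m : Set P} (h : Parallel l m) {x : P} (hl : x ∈ l) (hm : x ∈ m) :
    l = m := by
  rcases h with h | h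
  · exact h
  · have hx : x ∈ l ∩ m := ⟨hl, hm⟩
    rw [h] at hx
    exact hx.elim

theorem parallel_trans {l m n : Set P} (hl : l ∈ 𝒜.lines) (hm : m ∈ 𝒜.lines) (hn : n ∈ 𝒜.lines)
    (h₁ : Parallel l m) (h₂ : Parallel m n) : Parallel l n := by
  rcases Set.eq_empty_or_nonempty (l ∩ n) with h | ⟨x, hxl, hxn⟩
  · exact Or.inr h
  · left
    by_cases hx : x ∈ m
    · rw [h₁.eq_of_mem hxl hx, h₂.eq_of_mem hx hxn]
    · have e₁ : m ∩ l = ∅ := by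
        rcases h₁ with h | h
        · exact absurd (h ▸ hxl) hx
        · rw [Set.inter_comm]; exact h
      have e₂ : m ∩ n = ∅ := by
        rcases h₂ with h | h
        · exact absurd (h.symm ▸ hxn) hx
        · exact h
      exact (𝒜.playfair x m hm hx).unique ⟨hl, hxl, e₁⟩ ⟨hn, hxn, e₂⟩

theorem exists_inter_eq {l m : Set P} (hl : l ∈ 𝒜.lines) (hm : m ∈ 𝒜.lines)
    (h : ¬ Parallel l m) : ∃ x : P, l ∩ m = {x} := by
  have hne : (l ∩ m).Nonempty := by
    rw [Set.nonempty_iff_ne_empty]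
    exact fun h' => h (Or.inr h')
  obtain ⟨x, hxl, hxm⟩ := hne
  refine ⟨x, Set.eq_singleton_iff_unique_mem.2 ⟨⟨hxl, hxm⟩, ?_⟩⟩
  rintro y ⟨hyl, hym⟩
  by_contra hyx
  exact h (Or.inl ((𝒜.existsUnique_line y x hyx).unique ⟨hl, hyl, hxl⟩ ⟨hm, hym, hxm⟩))

theorem not_parallel_of_mem {l : Set P} {p q : P} (hp : p ∈ l) (hq : q ∉ l) :
    𝒜.line p q ∈ 𝒜.lines ∧ ¬ Parallel (𝒜.line p q) l := by
  have hpq : p ≠ q := fun h => hq (h ▸ hp)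
  obtain ⟨h₁, h₂, h₃⟩ := 𝒜.line_spec hpq
  exact ⟨h₁, fun h => hq (h.eq_of_mem h₂ hp ▸ h₃)⟩

theorem exists_notMem {l : Set P} (hl : l ∈ 𝒜.lines) : ∃ p : P, p ∉ l := by
  by_contra! h
  obtain ⟨p, q, r, -, -, -, H⟩ := 𝒜.exists_triangle
  exact H ⟨l, hl, h p, h q, h r⟩

theorem exists_isSum {O I : P} (h : O ≠ I) {A B : P} (hB : B ∈ 𝒜.line O I) :
    ∃ C, C ∈ 𝒜.line O I ∧ 𝒜.IsSum O I A B C := by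
  obtain ⟨hl, hO, -⟩ := 𝒜.line_spec h
  obtain ⟨B₁, hB₁⟩ := 𝒜.exists_notMem hl
  obtain ⟨k₁, k₂⟩ := 𝒜.not_parallel_of_mem hO hB₁
  obtain ⟨k₃, k₄⟩ := 𝒜.not_parallel_of_mem hB hB₁
  obtain ⟨a₁, -, a₃⟩ := 𝒜.parallelThrough_spec B₁ hl
  obtain ⟨b₁, -, b₃⟩ := 𝒜.parallelThrough_spec A k₁
  obtain ⟨P₁, hP₁⟩ := 𝒜.exists_inter_eq a₁ b₁ fun hp =>
    k₂ (𝒜.parallel_trans k₁ a₁ hl (𝒜.parallel_trans k₁ b₁ a₁ b₃.symm hp.symm) a₃)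
  obtain ⟨c₁, -, c₃⟩ := 𝒜.parallelThrough_spec P₁ k₃
  obtain ⟨C, hC⟩ := 𝒜.exists_inter_eq c₁ hl fun hp =>
    k₄ (𝒜.parallel_trans k₃ c₁ hl c₃.symm hp)
  have hCm : C ∈ 𝒜.parallelThrough P₁ (𝒜.line B B₁) ∩ 𝒜.line O I := by rw [hC]; rfl
  exact ⟨C, hCm.2, B₁, hB₁, P₁, hP₁, hC⟩

theorem exists_isProd {O I : P} (h : O ≠ I) {A B : P} (hB : B ∈ 𝒜.line O I) :
    ∃ C, C ∈ 𝒜.line O I ∧ 𝒜.IsProd O I A B C := by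
  obtain ⟨hl, hO, hI⟩ := 𝒜.line_spec h
  obtain ⟨B₁, hB₁⟩ := 𝒜.exists_notMem hl
  obtain ⟨k₁, k₂⟩ := 𝒜.not_parallel_of_mem hO hB₁
  obtain ⟨k₃, k₄⟩ := 𝒜.not_parallel_of_mem hB hB₁
  obtain ⟨k₅, k₆⟩ := 𝒜.not_parallel_of_mem hI hB₁
  obtain ⟨b₁, -, b₃⟩ := 𝒜.parallelThrough_spec A k₅
  have hOB₁ : O ≠ B₁ := fun e => hB₁ (e ▸ hO)
  have hIB₁ : I ≠ B₁ := fun e => hB₁ (e ▸ hI)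
  obtain ⟨P₁, hP₁⟩ := 𝒜.exists_inter_eq b₁ k₁ fun hp => by
    have hpar : Parallel (𝒜.line I B₁) (𝒜.line O B₁) := 𝒜.parallel_trans k₅ b₁ k₁ b₃.symm hp
    have he := hpar.eq_of_mem (𝒜.line_spec hIB₁).2.2 (𝒜.line_spec hOB₁).2.2
    have hIm : I ∈ 𝒜.line O B₁ := he ▸ (𝒜.line_spec hIB₁).2.1
    exact k₂ (Or.inl ((𝒜.existsUnique_line O I h).unique
      ⟨k₁, (𝒜.line_spec hOB₁).2.1, hIm⟩ ⟨hl, hO, hI⟩))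
  obtain ⟨c₁, -, c₃⟩ := 𝒜.parallelThrough_spec P₁ k₃
  obtain ⟨C, hC⟩ := 𝒜.exists_inter_eq c₁ hl fun hp =>
    k₄ (𝒜.parallel_trans k₃ c₁ hl c₃.symm hp)
  have hCm : C ∈ 𝒜.parallelThrough P₁ (𝒜.line B B₁) ∩ 𝒜.line O I := by rw [hC]; rfl
  exact ⟨C, hCm.2, B₁, hB₁, P₁, hP₁, hC⟩

/-! ### The algebra of the points of the line `OI` -/

/-- The points of the line `OI`, where `O ≠ I`. -/
def LinePoint {O I : P} (_h : O ≠ I) : Type _ := {X : P // X ∈ 𝒜.line O I}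

namespace LinePoint

variable {𝒜} {O I : P} {h : O ≠ I}

/-- The zero is the point `O`. -/
instance : Zero (𝒜.LinePoint h) := ⟨⟨O, (𝒜.line_spec h).2.1⟩⟩

/-- The unit is the point `I`. -/
instance : One (𝒜.LinePoint h) := ⟨⟨I, (𝒜.line_spec h).2.2⟩⟩

instance : Nonempty (𝒜.LinePoint h) := ⟨0⟩

/-- `A + B` is a point produced by the addition algorithm. Nothing is assumed about the auxiliary
point that is used; it may depend on `A` and `B`. -/
noncomputable instance : Add (𝒜.LinePoint h) :=
  ⟨fun A B => ⟨(𝒜.exists_isSum h (A := A.1) B.2).choose,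
    (𝒜.exists_isSum h (A := A.1) B.2).choose_spec.1⟩⟩

/-- `A * B` is a point produced by the multiplication algorithm. Nothing is assumed about the
auxiliary point that is used; it may depend on `A` and `B`. -/
noncomputable instance : Mul (𝒜.LinePoint h) :=
  ⟨fun A B => ⟨(𝒜.exists_isProd h (A := A.1) B.2).choose,
    (𝒜.exists_isProd h (A := A.1) B.2).choose_spec.1⟩⟩

/-- The additive inverse. -/
noncomputable instance : Neg (𝒜.LinePoint h) :=
  ⟨fun A => Classical.epsilon fun N => A + N = 0 ∧ N + A = 0⟩

noncomputable instance : Sub (𝒜.LinePoint h) := ⟨fun A B => A + -B⟩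

/-- The multiplicative inverse (only meaningful for points other than `O`). -/
noncomputable instance : Inv (𝒜.LinePoint h) :=
  ⟨fun A => Classical.epsilon fun N => A * N = 1 ∧ N * A = 1⟩

/-- The cross-ratio `c_r(A, B; C, D)` (only meaningful for `A ≠ D` and `B ≠ C`). -/
noncomputable def crossRatio (A B C D : 𝒜.LinePoint h) : 𝒜.LinePoint h :=
  ((A - D)⁻¹ * (B - D)) * ((B - C)⁻¹ * (A - C))

/-- The Möbius transform with base points `B, C, D`. -/
noncomputable def mobius (B C D X : 𝒜.LinePoint h) : 𝒜.LinePoint h := crossRatio X B C D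

/-- The set of Möbius points: all values `μ(X) = c_r(X, B; C, D)`, where `X` runs over the points
of the line for which the cross-ratio is defined, that is `X ≠ D`. -/
def mobiusPoints (B C D : 𝒜.LinePoint h) : Set (𝒜.LinePoint h) :=
  {R | ∃ X : 𝒜.LinePoint h, X ≠ D ∧ R = mobius B C D X}

end LinePoint

end AffinePlane

/-! The two laws hold for all points of `OI`, in particular for Möbius points. Both operations
evaluate dilatations: `x + y` is the image of `y` under the translation taking `O` to `x`, and `x *
y` is its image under the homothety with centre `O` taking `I` to `x` (`IsSum.eq_apply`,
`IsProd.eq_apply`). This is true for every auxiliary point, so the choice of that point is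
immaterial.

Desargues' axiom supplies the translations (parallel case) and the homotheties (central case), and a
dilatation is determined by its values at two points. A homothety conjugates translations into
translations, hence is additive (`map_apply`): this is the left law. The pointwise sum of two
homotheties with centre `O` is a dilatation (`isDilatation_add`); it fixes `O` and takes `I` to `x +
y`, so it evaluates multiplication by `x + y`: this is the right law.

Gluing a translation together needs a third line in each parallel class. If `OI` has only the points
`O` and `I`, the laws follow from the rules for 0 and 1. -/

/-! ### Gluing a map from local conditions -/

/-- The map sending the points of a type `U`, divided into classes by `c`, to points of `P`, and
determined by one value through a relation `Q` between point-image pairs of different classes. -/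
theorem exists_map_of_class_relation {U P : Type*} {c : U → U → Prop} {L : U → P → Prop}
    {Q : U → P → U → P → Prop} (c_equiv : Equivalence c)
    (Q_symm : ∀ {X X' Y Y'}, Q X X' Y Y' → Q Y Y' X X')
    (Q_right : ∀ {X X' Y Y'}, Q X X' Y Y' → L Y Y')
    (Q_exists : ∀ {X X' Y}, ¬ c X Y → L X X' → ∃ Y', Q X X' Y Y')
    (Q_unique : ∀ {X X' Y Y' Y''}, ¬ c X Y → Q X X' Y Y' → Q X X' Y Y'' → Y' = Y'')
    (Q_trans : ∀ {X X' Y Y' Z Z'}, ¬ c X Y → ¬ c Y Z → ¬ c X Z →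
      Q X X' Y Y' → Q Y Y' Z Z' → Q X X' Z Z')
    (third : ∀ X Y, ∃ Z, ¬ c X Z ∧ ¬ c Y Z) {A : U} {A' : P} (hA : L A A') :
    ∃ f : U → P, f A = A' ∧ ∀ X Y, ¬ c X Y → Q X (f X) Y (f Y) := by
  obtain ⟨B, hAB, -⟩ := third A A
  obtain ⟨B', hB⟩ := Q_exists hAB hA
  have hBX : ∀ {X}, c A X → ¬ c B X := fun h h' => hAB (c_equiv.trans h (c_equiv.symm h'))
  -- Images are constructed from `A` outside the class of `A`, and from the second base point `B`
  -- inside it.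
  have ex : ∀ X, ∃ X', (¬ c A X → Q A A' X X') ∧ (c A X → Q B B' X X') := by
    intro X
    by_cases h : c A X
    · obtain ⟨X', hX⟩ := Q_exists (hBX h) (Q_right hB)
      exact ⟨X', fun h' => absurd h h', fun _ => hX⟩
    · obtain ⟨X', hX⟩ := Q_exists h hA
      exact ⟨X', fun _ => hX, fun h' => absurd h' h⟩
  choose f off on using ex
  have far : ∀ {X Y}, ¬ c A X → ¬ c A Y → ¬ c X Y → Q X (f X) Y (f Y) := fun hX hY h =>
    Q_trans (fun h' => hX (c_equiv.symm h')) hY h (Q_symm (off _ hX)) (off _ hY)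
  have near : ∀ {X Y}, c A X → ¬ c A Y → ¬ c X Y → Q X (f X) Y (f Y) := by
    have key : ∀ {X Y}, c A X → ¬ c A Y → ¬ c X Y → ¬ c B Y → Q X (f X) Y (f Y) := by
      intro X Y hX hY h hBY
      have h₁ : Q B B' Y (f Y) :=
        Q_trans (fun h' => hAB (c_equiv.symm h')) hY hBY (Q_symm hB) (off _ hY)
      exact Q_trans (fun h' => hBX hX (c_equiv.symm h')) hBY h (Q_symm (on _ hX)) h₁
    intro X Y hX hY h
    by_cases hBY : c B Y
    -- Here `X` is in the class of `A` and `Y` in that of `B`, so neither base point links them; a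
    -- point of a third class does.
    · obtain ⟨Z, hAZ, hBZ⟩ := third A B
      have hZX : ¬ c X Z := fun h' => hAZ (c_equiv.trans hX h')
      have hZY : ¬ c Z Y := fun h' => hBZ (c_equiv.trans hBY (c_equiv.symm h'))
      exact Q_trans hZX hZY h (key hX hAZ hZX hBZ) (far hAZ hY hZY)
    · exact key hX hY h hBY
  refine ⟨f, ?_, fun X Y h => ?_⟩
  · exact Q_unique (hBX (c_equiv.refl A)) (on _ (c_equiv.refl A)) (Q_symm hB)
  · by_cases hX : c A X
    · exact near hX (fun hY => h (c_equiv.trans (c_equiv.symm hX) hY)) h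
    · by_cases hY : c A Y
      · exact Q_symm (near hY hX fun h' => h (c_equiv.symm h'))
      · exact far hX hY h

/-! ### Planes given by directions, and their dilatations -/

/-- An affine plane given by its set `D` of directions: `r d X Y` says that `X` and `Y` lie on a
line of direction `d`. -/
structure DirectionPlane (P D : Type*) where
  /-- The relation of being on a common line of a given direction. -/
  r : D → P → P → Prop
  equiv : ∀ d, Equivalence (r d)
  eq_of : ∀ {d e X Y}, d ≠ e → r d X Y → r e X Y → X = Y
  exists_dir : ∀ X Y, ∃ d, r d X Y
  exists_inter : ∀ {d e}, d ≠ e → ∀ X Y, ∃ Z, r d X Z ∧ r e Y Z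
  exists_dir_ne : ∀ d e : D, ∃ f, f ≠ d ∧ f ≠ e
  exists_point_ne : ∀ X : P, ∃ Y, Y ≠ X

namespace DirectionPlane

variable {P D : Type*} (N : DirectionPlane P D)

/-- Desargues' axiom for triangles in perspective from a point at infinity. -/
def MinorDesargues : Prop :=
  ∀ d A B C A' B' C', ¬ N.r d A B → ¬ N.r d B C → ¬ N.r d A C →
    N.r d A A' → N.r d B B' → N.r d C C' →
    (∀ e, N.r e A B → N.r e A' B') → (∀ e, N.r e B C → N.r e B' C') →
    ∀ e, N.r e A C → N.r e A' C'

/-- Desargues' axiom for triangles in perspective from the point `S`. -/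
def CentralDesargues : Prop :=
  ∀ S a b c A B C A' B' C', a ≠ b → b ≠ c → a ≠ c → A ≠ S → B ≠ S → C ≠ S →
    N.r a S A → N.r a S A' → N.r b S B → N.r b S B' → N.r c S C → N.r c S C' →
    (∀ e, N.r e A B → N.r e A' B') → (∀ e, N.r e B C → N.r e B' C') →
    ∀ e, N.r e A C → N.r e A' C'

/-- A dilatation maps each line into a parallel line; constant maps are allowed. -/
def IsDilatation (f : P → P) : Prop := ∀ d X Y, N.r d X Y → N.r d (f X) (f Y)

variable {N}

theorem refl (d : D) (X : P) : N.r d X X := (N.equiv d).refl X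

theorem symm {d : D} {X Y : P} (h : N.r d X Y) : N.r d Y X := (N.equiv d).symm h

theorem trans {d : D} {X Y Z : P} (h : N.r d X Y) (h' : N.r d Y Z) : N.r d X Z :=
  (N.equiv d).trans h h'

theorem dir_unique {d e : D} {X Y : P} (h : X ≠ Y) (hd : N.r d X Y) (he : N.r e X Y) : d = e := by
  by_contra hne
  exact h (N.eq_of hne hd he)

theorem exists_ne_on (N : DirectionPlane P D) (d : D) (X : P) : ∃ Y, Y ≠ X ∧ N.r d X Y := by
  obtain ⟨Y, hY⟩ := N.exists_point_ne X
  obtain ⟨k, hk⟩ := N.exists_dir X Y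
  by_cases hkd : k = d
  · exact ⟨Y, hY, hkd ▸ hk⟩
  · obtain ⟨e, hed, hek⟩ := N.exists_dir_ne d k
    obtain ⟨Z, hZ, hZ'⟩ := N.exists_inter hed.symm X Y
    refine ⟨Z, ?_, hZ⟩
    rintro rfl
    exact hY (N.eq_of hek hZ' (symm hk))

theorem exists_off (N : DirectionPlane P D) (d : D) (X : P) : ∃ Y, ¬ N.r d X Y := by
  obtain ⟨e, he, -⟩ := N.exists_dir_ne d d
  obtain ⟨Y, hY, hXY⟩ := N.exists_ne_on e X
  exact ⟨Y, fun h => hY (N.eq_of he hXY h).symm⟩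

theorem isDilatation_id : N.IsDilatation id := fun _ _ _ h => h

theorem IsDilatation.comp {f g : P → P} (hf : N.IsDilatation f) (hg : N.IsDilatation g) :
    N.IsDilatation (f ∘ g) := fun d X Y h => hf d _ _ (hg d X Y h)

/-- A point `X` off the line `AB` is where `AX` and `BX` meet, so its image is determined by those
of `A` and `B`. For `X` on `AB`, the point `B` is replaced by a point off the line. -/
theorem IsDilatation.ext {f g : P → P} (hf : N.IsDilatation f) (hg : N.IsDilatation g) {A B : P}
    (hAB : A ≠ B) (hA : f A = g A) (hB : f B = g B) : f = g := by
  have off : ∀ {A B X : P} {d : D}, A ≠ B → f A = g A → f B = g B → N.r d A B → ¬ N.r d A X →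
      f X = g X := by
    intro A B X d hAB hA hB hd hX
    obtain ⟨a, ha⟩ := N.exists_dir A X
    obtain ⟨b, hb⟩ := N.exists_dir B X
    have hab : a ≠ b := by
      rintro rfl
      have : a = d := dir_unique hAB (trans ha (symm hb)) hd
      exact hX (this ▸ ha)
    have h₁ := hf a _ _ ha
    have h₂ := hg a _ _ ha
    have h₃ := hf b _ _ hb
    have h₄ := hg b _ _ hb
    rw [hA] at h₁
    rw [hB] at h₃
    exact N.eq_of hab (trans (symm h₁) h₂) (trans (symm h₃) h₄)
  obtain ⟨d, hd⟩ := N.exists_dir A B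
  obtain ⟨C, hC⟩ := N.exists_off d A
  have hfC := off hAB hA hB hd hC
  funext X
  by_cases hX : N.r d A X
  · by_cases hXA : X = A
    · rw [hXA, hA]
    · obtain ⟨e, he⟩ := N.exists_dir A C
      have hAC : A ≠ C := fun h => hC (h ▸ refl d A)
      refine off hAC hA hfC he fun h => hC ?_
      have : d = e := dir_unique (Ne.symm hXA) hX h
      exact this ▸ he
  · exact off hAB hA hB hd hX

/-- For `X` off the `d`-line of `A`, the image is where the `d`-line of `X` meets the parallel to
`AX` through the image of `A`. Agreement at a second point follows. -/
theorem IsDilatation.ext_of_trace {f g : P → P} (hf : N.IsDilatation f) (hg : N.IsDilatation g)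
    {d : D} (hfd : ∀ X, N.r d X (f X)) (hgd : ∀ X, N.r d X (g X)) {A : P} (hA : f A = g A) :
    f = g := by
  obtain ⟨X, hX⟩ := N.exists_off d A
  obtain ⟨e, he⟩ := N.exists_dir A X
  have hde : d ≠ e := fun h => hX (h ▸ he)
  have hAX : A ≠ X := fun h => hX (h ▸ refl d A)
  refine hf.ext hg hAX hA (N.eq_of hde (trans (symm (hfd X)) (hgd X)) ?_)
  have h₁ := hf e _ _ he
  rw [hA] at h₁
  exact trans (symm h₁) (hg e _ _ he)

/-! ### Existence of homotheties -/

/-- A homothety with centre `S` moving `A` to any given point of the line `SA`. -/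
theorem exists_homothety (hN : N.CentralDesargues) {S A A' : P} {a : D} (hA : A ≠ S)
    (ha : N.r a S A) (ha' : N.r a S A') :
    ∃ f, N.IsDilatation f ∧ f S = S ∧ f A = A' := by
  -- Classes are the lines through `S`. `Q` says that `X'`, `Y'` stay on their lines and `X'Y'` is
  -- parallel to `XY`; its transitivity is the central Desargues axiom.
  let c : {X // X ≠ S} → {X // X ≠ S} → Prop := fun X Y => ∃ b, N.r b S X ∧ N.r b S Y
  let L : {X // X ≠ S} → P → Prop := fun X X' => ∀ b, N.r b S X → N.r b S X'
  let Q : {X // X ≠ S} → P → {X // X ≠ S} → P → Prop := fun X X' Y Y' =>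
    L X X' ∧ L Y Y' ∧ ∀ e, N.r e X Y → N.r e X' Y'
  have hce : Equivalence c := by
    refine ⟨fun X => ?_, fun ⟨b, h, h'⟩ => ⟨b, h', h⟩, ?_⟩
    · obtain ⟨b, hb⟩ := N.exists_dir S X
      exact ⟨b, hb, hb⟩
    · rintro X Y Z ⟨b, h₁, h₂⟩ ⟨b', h₃, h₄⟩
      obtain rfl : b = b' := dir_unique Y.2.symm h₂ h₃
      exact ⟨b, h₁, h₄⟩
  have hdir : ∀ {X Y : {X // X ≠ S}} {b e : D}, ¬ c X Y → N.r b S Y → N.r e X Y → b ≠ e := by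
    rintro X Y b e hc hb he rfl
    exact hc ⟨b, trans hb (symm he), hb⟩
  have hL : ∀ {X : {X // X ≠ S}} {X' : P} {b : D}, N.r b S X → N.r b S X' → L X X' := by
    intro X X' b hb hb' b' hb''
    obtain rfl : b = b' := dir_unique X.2.symm hb hb''
    exact hb'
  obtain ⟨f, hfA, hf⟩ := exists_map_of_class_relation (c := c) (L := L) (Q := Q) (A := ⟨A, hA⟩)
    (A' := A') hce
    (fun ⟨h₁, h₂, h₃⟩ => ⟨h₂, h₁, fun e he => symm (h₃ e (symm he))⟩)
    (fun h => h.2.1)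
    (by
      intro X X' Y hc hX
      obtain ⟨b, hb⟩ := N.exists_dir S Y
      obtain ⟨e, he⟩ := N.exists_dir X Y
      obtain ⟨Y', h₁, h₂⟩ := N.exists_inter (hdir hc hb he) S X'
      refine ⟨Y', hX, hL hb h₁, fun e' he' => ?_⟩
      have hXY : X.1 ≠ Y.1 := fun h => hc (Subtype.ext h ▸ hce.refl X)
      obtain rfl : e = e' := dir_unique hXY he he'
      exact h₂)
    (by
      rintro X X' Y Y' Y'' hc ⟨-, h₁, h₂⟩ ⟨-, h₃, h₄⟩
      obtain ⟨b, hb⟩ := N.exists_dir S Y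
      obtain ⟨e, he⟩ := N.exists_dir X Y
      exact N.eq_of (hdir hc hb he) (trans (symm (h₁ b hb)) (h₃ b hb))
        (trans (symm (h₂ e he)) (h₄ e he)))
    (by
      rintro X X' Y Y' Z Z' hXY hYZ hXZ ⟨h₁, h₂, h₃⟩ ⟨-, h₄, h₅⟩
      refine ⟨h₁, h₄, ?_⟩
      obtain ⟨a, ha⟩ := N.exists_dir S X
      obtain ⟨b, hb⟩ := N.exists_dir S Y
      obtain ⟨c, hc⟩ := N.exists_dir S Z
      exact hN S a b c X Y Z X' Y' Z' (fun h => hXY ⟨a, ha, h ▸ hb⟩) (fun h => hYZ ⟨b, hb, h ▸ hc⟩)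
        (fun h => hXZ ⟨a, ha, h ▸ hc⟩) X.2 Y.2 Z.2 ha (h₁ a ha) hb (h₂ b hb) hc (h₄ c hc) h₃ h₅)
    (by
      intro X Y
      obtain ⟨a, ha⟩ := N.exists_dir S X
      obtain ⟨b, hb⟩ := N.exists_dir S Y
      obtain ⟨k, hka, hkb⟩ := N.exists_dir_ne a b
      obtain ⟨Z, hZ, hSZ⟩ := N.exists_ne_on k S
      refine ⟨⟨Z, hZ⟩, ?_, ?_⟩
      · rintro ⟨e, h₁, h₂⟩
        exact hka ((dir_unique hZ.symm hSZ h₂).trans (dir_unique X.2.symm h₁ ha))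
      · rintro ⟨e, h₁, h₂⟩
        exact hkb ((dir_unique hZ.symm hSZ h₂).trans (dir_unique Y.2.symm h₁ hb)))
    (hL ha ha')
  have hfL : ∀ X, L X (f X) := by
    intro X
    obtain ⟨a, ha⟩ := N.exists_dir S X
    obtain ⟨k, hka, -⟩ := N.exists_dir_ne a a
    obtain ⟨Z, hZ, hSZ⟩ := N.exists_ne_on k S
    refine (hf X ⟨Z, hZ⟩ ?_).1
    rintro ⟨e, h₁, h₂⟩
    exact hka ((dir_unique hZ.symm hSZ h₂).trans (dir_unique X.2.symm h₁ ha))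
  classical
  refine ⟨fun X => if h : X = S then S else f ⟨X, h⟩, fun e X Y he => ?_, by simp,
    by simp [hA, hfA]⟩
  by_cases hX : X = S <;> by_cases hY : Y = S
  · simpa [hX, hY] using refl e S
  · subst hX
    simpa [hY] using hfL ⟨Y, hY⟩ e he
  · subst hY
    simpa [hX] using symm (hfL ⟨X, hX⟩ e (symm he))
  · simp only [hX, hY, dif_neg, not_false_eq_true]
    by_cases hc : c ⟨X, hX⟩ ⟨Y, hY⟩
    · obtain ⟨b, h₁, h₂⟩ := hc
      by_cases hXY : X = Y
      · subst hXY
        exact refl e _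
      · obtain rfl : b = e := dir_unique hXY (trans (symm h₁) h₂) he
        exact trans (symm (hfL ⟨X, hX⟩ b h₁)) (hfL ⟨Y, hY⟩ b h₂)
    · exact (hf _ _ hc).2.2 e he

/-! ### Existence of translations -/

/-- Three points on a line not of direction `e` lie on three different `e`-lines, so two `e`-lines
cannot cover the plane. If the given line has direction `e`, its points are first projected to a
line of another direction. -/
theorem exists_off_two (N : DirectionPlane P D) {d : D} {X Y Z : P} (hXY : X ≠ Y) (hXZ : X ≠ Z)
    (hYZ : Y ≠ Z) (hdY : N.r d X Y) (hdZ : N.r d X Z) (e : D) (A B : P) :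
    ∃ C, ¬ N.r e A C ∧ ¬ N.r e B C := by
  have key : ∀ {e k : D} {X Y Z : P}, X ≠ Y → X ≠ Z → Y ≠ Z → N.r k X Y → N.r k X Z → e ≠ k →
      ∃ C, ¬ N.r e A C ∧ ¬ N.r e B C := by
    intro e k X Y Z hXY hXZ hYZ h₁ h₂ hek
    by_contra! h
    have hXY' : ¬ N.r e X Y := fun h' => hXY (N.eq_of hek h' h₁)
    have hXZ' : ¬ N.r e X Z := fun h' => hXZ (N.eq_of hek h' h₂)
    have hYZ' : ¬ N.r e Y Z := fun h' => hYZ (N.eq_of hek h' (trans (symm h₁) h₂))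
    have hAA : ∀ {U V}, N.r e A U → N.r e A V → N.r e U V := fun h h' => trans (symm h) h'
    have hBB : ∀ {U V}, N.r e B U → N.r e B V → N.r e U V := fun h h' => trans (symm h) h'
    by_cases hX : N.r e A X
    · exact hYZ' (hBB (h Y fun h' => hXY' (hAA hX h')) (h Z fun h' => hXZ' (hAA hX h')))
    · by_cases hY : N.r e A Y
      · exact hXZ' (hBB (h X hX) (h Z fun h' => hYZ' (hAA hY h')))
      · exact hXY' (hBB (h X hX) (h Y hY))
  by_cases hed : e = d
  · subst hed
    obtain ⟨k, hk, -⟩ := N.exists_dir_ne e e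
    obtain ⟨m, hme, hmk⟩ := N.exists_dir_ne e k
    obtain ⟨Y', hY₁, hY₂⟩ := N.exists_inter hmk.symm X Y
    obtain ⟨Z', hZ₁, hZ₂⟩ := N.exists_inter hmk.symm X Z
    refine key (k := k) (X := X) (Y := Y') (Z := Z') ?_ ?_ ?_ hY₁ hZ₁ hk.symm
    · rintro rfl
      exact hXY (N.eq_of hme (symm hY₂) hdY)
    · rintro rfl
      exact hXZ (N.eq_of hme (symm hZ₂) hdZ)
    · rintro rfl
      exact hYZ (N.eq_of hme (trans hY₂ (symm hZ₂)) (trans (symm hdY) hdZ))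
  · exact key hXY hXZ hYZ hdY hdZ hed

/-- A translation along the lines of direction `d` moving `A` to any given point of its line. -/
theorem exists_translation (hN : N.MinorDesargues)
    (third : ∀ e A B, ∃ C, ¬ N.r e A C ∧ ¬ N.r e B C) {A A' : P} {d : D} (hA : N.r d A A') :
    ∃ f, N.IsDilatation f ∧ (∀ X, N.r d X (f X)) ∧ f A = A' := by
  let Q : P → P → P → P → Prop := fun X X' Y Y' =>
    N.r d X X' ∧ N.r d Y Y' ∧ ∀ e, N.r e X Y → N.r e X' Y'
  obtain ⟨f, hfA, hf⟩ := exists_map_of_class_relation (c := N.r d) (L := N.r d) (Q := Q)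
    (N.equiv d)
    (fun ⟨h₁, h₂, h₃⟩ => ⟨h₂, h₁, fun e he => symm (h₃ e (symm he))⟩)
    (fun h => h.2.1)
    (by
      intro X X' Y hc hX
      obtain ⟨e, he⟩ := N.exists_dir X Y
      have hde : d ≠ e := fun h => hc (h ▸ he)
      obtain ⟨Y', h₁, h₂⟩ := N.exists_inter hde Y X'
      refine ⟨Y', hX, h₁, fun e' he' => ?_⟩
      have hXY : X ≠ Y := fun h => hc (h ▸ refl d X)
      obtain rfl : e = e' := dir_unique hXY he he'
      exact h₂)
    (by
      rintro X X' Y Y' Y'' hc ⟨-, h₁, h₂⟩ ⟨-, h₃, h₄⟩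
      obtain ⟨e, he⟩ := N.exists_dir X Y
      have hde : d ≠ e := fun h => hc (h ▸ he)
      exact N.eq_of hde (trans (symm h₁) h₃) (trans (symm (h₂ e he)) (h₄ e he)))
    (by
      rintro X X' Y Y' Z Z' hXY hYZ hXZ ⟨h₁, h₂, h₃⟩ ⟨-, h₄, h₅⟩
      exact ⟨h₁, h₄, hN d X Y Z X' Y' Z' hXY hYZ hXZ h₁ h₂ h₄ h₃ h₅⟩)
    (third d) hA
  have hfd : ∀ X, N.r d X (f X) := by
    intro X
    obtain ⟨Y, hY⟩ := N.exists_off d X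
    exact (hf X Y hY).1
  refine ⟨f, fun e X Y he => ?_, hfd, hfA⟩
  by_cases hd : N.r d X Y
  · by_cases hXY : X = Y
    · exact hXY ▸ refl e _
    · obtain rfl : d = e := dir_unique hXY hd he
      exact trans (symm (hfd X)) (trans hd (hfd Y))
  · exact (hf X Y hd).2.2 e he

/-! ### The commutative group of translations -/

/-- The translations `t p`, indexed by the image `p` of the origin `O`. -/
structure IsTranslationFamily (N : DirectionPlane P D) (O : P) (t : P → P → P) : Prop where
  isDilatation : ∀ p, N.IsDilatation (t p)
  trace : ∀ {d p}, N.r d O p → ∀ X, N.r d X (t p X)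
  apply_origin : ∀ p, t p O = p

theorem exists_isTranslationFamily (hN : N.MinorDesargues)
    (third : ∀ e A B, ∃ C, ¬ N.r e A C ∧ ¬ N.r e B C) (O : P) :
    ∃ t, N.IsTranslationFamily O t := by
  have ex : ∀ p, ∃ f, N.IsDilatation f ∧ (∀ d, N.r d O p → ∀ X, N.r d X (f X)) ∧ f O = p := by
    intro p
    by_cases hp : O = p
    -- Every direction joins `O` to itself, so for `p = O` all traces must be preserved at once.
    · exact ⟨id, isDilatation_id, fun d _ X => refl d X, hp⟩
    · obtain ⟨d, hd⟩ := N.exists_dir O p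
      obtain ⟨f, h₁, h₂, h₃⟩ := exists_translation hN third hd
      refine ⟨f, h₁, fun e he => ?_, h₃⟩
      obtain rfl : d = e := dir_unique hp hd he
      exact h₂
  choose t h₁ h₂ h₃ using ex
  exact ⟨t, h₁, fun {d p} => h₂ p d, h₃⟩

namespace IsTranslationFamily

variable {O : P} {t : P → P → P}

theorem eq_of_trace (ht : N.IsTranslationFamily O t) {f : P → P} {d : D} (hf : N.IsDilatation f)
    (hd : ∀ X, N.r d X (f X)) : f = t (f O) :=
  hf.ext_of_trace (ht.isDilatation _) hd (ht.trace (hd O)) (ht.apply_origin _).symm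

/-- Both sides are the fourth vertex of the parallelogram on `O`, `p`, `q`. -/
theorem apply_swap_of_ne (ht : N.IsTranslationFamily O t) {p q : P} {d e : D} (hde : d ≠ e)
    (hp : N.r d O p) (hq : N.r e O q) : t p q = t q p := by
  have h₁ := ht.isDilatation p e _ _ hq
  have h₂ := ht.isDilatation q d _ _ hp
  rw [ht.apply_origin] at h₁ h₂
  exact N.eq_of hde (trans (symm (ht.trace hp q)) h₂) (trans (symm h₁) (ht.trace hq p))

theorem exists_neg (ht : N.IsTranslationFamily O t) (hN : N.MinorDesargues)
    (third : ∀ e A B, ∃ C, ¬ N.r e A C ∧ ¬ N.r e B C) (q : P) :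
    ∃ g : P → P, ∀ X, t q (g X) = X ∧ g (t q X) = X := by
  obtain ⟨d, hd⟩ := N.exists_dir O q
  obtain ⟨g, h₁, h₂, h₃⟩ := exists_translation hN third (symm hd)
  have e₁ : t q ∘ g = id := by
    refine ((ht.isDilatation q).comp h₁).ext_of_trace isDilatation_id (d := d) (A := q)
      (fun X => trans (h₂ X) (ht.trace hd _)) (fun X => refl d X) ?_
    simp [h₃, ht.apply_origin]
  have e₂ : g ∘ t q = id := by
    refine (h₁.comp (ht.isDilatation q)).ext_of_trace isDilatation_id (d := d) (A := O)
      (fun X => trans (ht.trace hd _) (h₂ _)) (fun X => refl d X) ?_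
    simp [h₃, ht.apply_origin]
  exact ⟨g, fun X => ⟨congrFun e₁ X, congrFun e₂ X⟩⟩

/-- For a common direction the composite preserves the lines of that direction. Otherwise both sides
are compared at `O` and at the preimage of `O` under `t q`. -/
theorem comp_eq (ht : N.IsTranslationFamily O t) (hN : N.MinorDesargues)
    (third : ∀ e A B, ∃ C, ¬ N.r e A C ∧ ¬ N.r e B C) (p q : P) :
    t p ∘ t q = t (t p q) := by
  have hdil := (ht.isDilatation p).comp (ht.isDilatation q)
  have hO : (t p ∘ t q) O = t p q := by simp [ht.apply_origin]
  by_cases h : ∃ d, N.r d O p ∧ N.r d O q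
  · obtain ⟨d, hp, hq⟩ := h
    have := ht.eq_of_trace hdil (d := d) fun X => trans (ht.trace hq X) (ht.trace hp _)
    rwa [hO] at this
  · obtain ⟨d, hp⟩ := N.exists_dir O p
    obtain ⟨e, hq⟩ := N.exists_dir O q
    have hde : d ≠ e := fun h' => h ⟨d, hp, h' ▸ hq⟩
    have hOp : O ≠ p := fun h' => h ⟨e, h' ▸ refl e O, hq⟩
    have hOq : O ≠ q := fun h' => h ⟨d, hp, h' ▸ refl d O⟩
    obtain ⟨g, hg⟩ := ht.exists_neg hN third q
    have hcomm := ht.apply_swap_of_ne hde hp hq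
    have hgO : N.r e (g O) O := by simpa [(hg O).1] using ht.trace hq (g O)
    have hne : O ≠ g O := by
      intro h'
      have := (hg O).1
      rw [← h', ht.apply_origin] at this
      exact hOq this.symm
    refine hdil.ext (ht.isDilatation _) hne (by rw [hO, ht.apply_origin]) ?_
    simp only [Function.comp, (hg O).1, ht.apply_origin]
    -- `p` is on the `k`-line of `g O`, because `t q` carries the pair `g O`, `p` to `O`, `t p q`.
    -- It is also on the `e`-line of `t p q`.
    obtain ⟨k, hk⟩ := N.exists_dir O (t p q)
    have hke : k ≠ e := by
      rintro rfl
      have := ht.trace hq p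
      rw [← hcomm] at this
      exact hde (dir_unique hOp hp (trans hk (symm this)))
    refine N.eq_of hke ?_ ?_
    · refine trans (symm ?_) (ht.trace hk (g O))
      obtain ⟨m, hm⟩ := N.exists_dir (g O) p
      have h₁ := ht.isDilatation q m _ _ hm
      rw [(hg O).1, ← hcomm] at h₁
      have hOr : O ≠ t p q := by
        intro h'
        refine hde (dir_unique hOp hp ?_)
        have := ht.trace hq p
        rw [← hcomm, ← h'] at this
        exact symm this
      obtain rfl : m = k := dir_unique hOr h₁ hk
      exact hm
    · have h₁ := ht.isDilatation (t p q) e _ _ hgO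
      rw [ht.apply_origin] at h₁
      have h₂ := ht.trace hq p
      rw [← hcomm] at h₂
      exact trans h₂ (symm h₁)

/-- If `p` and `q` have the same direction, take `s` off their line: `p` commutes with both `s` and
`s + q`, and cancelling `s` gives the claim. -/
theorem apply_comm (ht : N.IsTranslationFamily O t) (hN : N.MinorDesargues)
    (third : ∀ e A B, ∃ C, ¬ N.r e A C ∧ ¬ N.r e B C) (p q : P) : t p q = t q p := by
  have assoc : ∀ p q X, t (t p q) X = t p (t q X) := fun p q X =>
    (congrFun (ht.comp_eq hN third p q) X).symm
  obtain ⟨d, hp⟩ := N.exists_dir O p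
  obtain ⟨e, hq⟩ := N.exists_dir O q
  by_cases hde : d = e
  · subst hde
    obtain ⟨s, hs⟩ := N.exists_off d O
    obtain ⟨k, hk⟩ := N.exists_dir O s
    have hdk : d ≠ k := fun h => hs (h ▸ hk)
    have hps := ht.apply_swap_of_ne hdk hp hk
    have hqs := ht.apply_swap_of_ne hdk hq hk
    obtain ⟨m, hm⟩ := N.exists_dir O (t s q)
    have hdm : d ≠ m := by
      rintro rfl
      have := ht.trace hq s
      rw [hqs] at this
      exact hs (trans hm (symm this))
    have h₁ := ht.apply_swap_of_ne hdm hp hm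
    rw [← assoc, hps, assoc, assoc] at h₁
    obtain ⟨g, hg⟩ := ht.exists_neg hN third s
    rw [← (hg (t p q)).2, h₁, (hg _).2]
  · exact ht.apply_swap_of_ne hde hp hq

/-- The dilatations `f ∘ t p` and `t (f p) ∘ f` agree at `O` and at a point off the line `Op`. -/
theorem map_apply (ht : N.IsTranslationFamily O t) {f : P → P} (hf : N.IsDilatation f)
    (hO : f O = O) (p q : P) : f (t p q) = t (f p) (f q) := by
  suffices f ∘ t p = t (f p) ∘ f from congrFun this q
  obtain ⟨d, hp⟩ := N.exists_dir O p
  obtain ⟨q, hq⟩ := N.exists_off d O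
  obtain ⟨e, he⟩ := N.exists_dir O q
  have hde : d ≠ e := fun h => hq (h ▸ he)
  have hOq : O ≠ q := fun h => hq (h ▸ refl d O)
  refine (hf.comp (ht.isDilatation p)).ext ((ht.isDilatation (f p)).comp hf) hOq ?_ ?_
  · simp [ht.apply_origin, hO]
  · have hfp := hf d _ _ hp
    have hfq := hf e _ _ he
    rw [hO] at hfp hfq
    have h₁ := hf d _ _ (ht.trace hp q)
    have h₂ := ht.trace hfp (f q)
    have h₃ := ht.isDilatation p e _ _ he
    have h₄ := ht.isDilatation (f p) e _ _ hfq
    rw [ht.apply_origin] at h₃ h₄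
    exact N.eq_of hde (trans (symm h₁) h₂) (trans (symm (hf e _ _ h₃)) h₄)

/-- The pointwise sum of two dilatations with the same fixed point is a dilatation. -/
theorem isDilatation_add (ht : N.IsTranslationFamily O t) (hN : N.MinorDesargues)
    (third : ∀ e A B, ∃ C, ¬ N.r e A C ∧ ¬ N.r e B C) {f g : P → P} (hf : N.IsDilatation f)
    (hg : N.IsDilatation g) (hfO : f O = O) (hgO : g O = O) :
    N.IsDilatation fun X => t (f X) (g X) := by
  have assoc : ∀ p q X, t (t p q) X = t p (t q X) := fun p q X =>
    (congrFun (ht.comp_eq hN third p q) X).symm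
  intro e X Y he
  -- `u Y` plays the role of `Y - X`. By additivity the sum at `Y` is the sum at `X` moved by `f (u
  -- Y)` and `g (u Y)`, both along `e`.
  obtain ⟨u, hu⟩ := ht.exists_neg hN third X
  have hY : t (u Y) X = Y := by rw [ht.apply_comm hN third, (hu Y).1]
  have hw : N.r e O (u Y) := by
    by_cases hXY : X = Y
    · have h₁ : t X O = Y := by rw [ht.apply_origin, hXY]
      rw [← h₁, (hu O).2]
      exact refl e O
    · obtain ⟨k, hk⟩ := N.exists_dir O (u Y)
      have h₁ := ht.trace hk X
      rw [hY] at h₁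
      obtain rfl : k = e := dir_unique hXY h₁ he
      exact hk
  have hfw := hf e _ _ hw
  have hgw := hg e _ _ hw
  rw [hfO] at hfw
  rw [hgO] at hgw
  have hsum : t (f Y) (g Y) = t (f (u Y)) (t (g (u Y)) (t (f X) (g X))) := by
    conv_lhs => rw [← hY, ht.map_apply hf hfO, ht.map_apply hg hgO]
    rw [assoc, ← assoc (f X), ht.apply_comm hN third (f X), assoc]
  simp only [hsum]
  exact trans (ht.trace hgw _) (ht.trace hfw _)

end IsTranslationFamily

end DirectionPlane

/-! ### The directions of an affine plane -/

namespace AffinePlane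

variable {P : Type*} (𝒜 : AffinePlane P)

theorem line_unique {l m : Set P} {X Y : P} (h : X ≠ Y) (hl : l ∈ 𝒜.lines) (hm : m ∈ 𝒜.lines)
    (hXl : X ∈ l) (hYl : Y ∈ l) (hXm : X ∈ m) (hYm : Y ∈ m) : l = m :=
  (𝒜.existsUnique_line X Y h).unique ⟨hl, hXl, hYl⟩ ⟨hm, hXm, hYm⟩

/-- `X` and `Y` lie on a common line parallel to `l`. -/
def Aligned (l : Set P) (X Y : P) : Prop := ∃ m ∈ 𝒜.lines, Parallel m l ∧ X ∈ m ∧ Y ∈ m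

theorem exists_mem_line (X : P) : ∃ l ∈ 𝒜.lines, X ∈ l := by
  obtain ⟨p, q, -, hpq, -⟩ := 𝒜.exists_triangle
  by_cases h : X = p
  · exact ⟨_, (𝒜.line_spec hpq).1, h ▸ (𝒜.line_spec hpq).2.1⟩
  · exact ⟨_, (𝒜.line_spec h).1, (𝒜.line_spec h).2.1⟩

/-- The directions of the plane, represented by the lines through `O`. -/
def Direction (O : P) : Type _ := {l : Set P // l ∈ 𝒜.lines ∧ O ∈ l}

theorem aligned_iff {l m : Set P} (hm : m ∈ 𝒜.lines) {X Y : P} (h : X ≠ Y)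
    (hX : X ∈ m) (hY : Y ∈ m) : 𝒜.Aligned l X Y ↔ Parallel m l := by
  refine ⟨?_, fun h' => ⟨m, hm, h', hX, hY⟩⟩
  rintro ⟨n, hn, hnl, hXn, hYn⟩
  rwa [𝒜.line_unique h hm hn hX hY hXn hYn]

theorem aligned_line_iff {l : Set P} {X Y : P} (h : X ≠ Y) :
    𝒜.Aligned l X Y ↔ Parallel (𝒜.line X Y) l :=
  𝒜.aligned_iff (𝒜.line_spec h).1 h (𝒜.line_spec h).2.1 (𝒜.line_spec h).2.2

theorem aligned_equivalence {l : Set P} (hl : l ∈ 𝒜.lines) : Equivalence (𝒜.Aligned l) := by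
  refine ⟨fun X => ?_, fun ⟨m, h₁, h₂, h₃, h₄⟩ => ⟨m, h₁, h₂, h₄, h₃⟩, ?_⟩
  · obtain ⟨h₁, h₂, h₃⟩ := 𝒜.parallelThrough_spec X hl
    exact ⟨_, h₁, h₃, h₂, h₂⟩
  · rintro X Y Z ⟨m, hm, hml, hXm, hYm⟩ ⟨n, hn, hnl, hYn, hZn⟩
    have : m = n := (𝒜.parallel_trans hm hl hn hml hnl.symm).eq_of_mem hYm hYn
    exact ⟨m, hm, hml, hXm, this ▸ hZn⟩

theorem exists_direction_parallel (O : P) {m : Set P} (hm : m ∈ 𝒜.lines) :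
    ∃ d : 𝒜.Direction O, Parallel m d.1 := by
  obtain ⟨h₁, h₂, h₃⟩ := 𝒜.parallelThrough_spec O hm
  exact ⟨⟨_, h₁, h₂⟩, h₃.symm⟩

theorem direction_eq_of_parallel {O : P} {d e : 𝒜.Direction O} {m : Set P} (hm : m ∈ 𝒜.lines)
    (hd : Parallel m d.1) (he : Parallel m e.1) : d = e :=
  Subtype.ext ((𝒜.parallel_trans d.2.1 hm e.2.1 hd.symm he).eq_of_mem d.2.2 e.2.2)

theorem exists_aligned (O X Y : P) : ∃ d : 𝒜.Direction O, 𝒜.Aligned d.1 X Y := by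
  have : ∃ m ∈ 𝒜.lines, X ∈ m ∧ Y ∈ m := by
    by_cases h : X = Y
    · obtain ⟨m, hm, hX⟩ := 𝒜.exists_mem_line X
      exact ⟨m, hm, hX, h ▸ hX⟩
    · exact ⟨_, 𝒜.line_spec h⟩
  obtain ⟨m, hm, hX, hY⟩ := this
  obtain ⟨d, hd⟩ := 𝒜.exists_direction_parallel O hm
  exact ⟨d, m, hm, hd, hX, hY⟩

/-- The plane as a family of alignment relations, indexed by the directions. -/
def directionPlane (O : P) : DirectionPlane P (𝒜.Direction O) where
  r d := 𝒜.Aligned d.1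
  equiv d := 𝒜.aligned_equivalence d.2.1
  eq_of := by
    rintro d e X Y hde ⟨m, hm, hmd, hX, hY⟩ ⟨n, hn, hne, hX', hY'⟩
    by_contra h
    obtain rfl := 𝒜.line_unique h hm hn hX hY hX' hY'
    exact hde (𝒜.direction_eq_of_parallel hm hmd hne)
  exists_dir := 𝒜.exists_aligned O
  exists_inter := by
    intro d e hde X Y
    obtain ⟨h₁, h₂, h₃⟩ := 𝒜.parallelThrough_spec X d.2.1
    obtain ⟨h₄, h₅, h₆⟩ := 𝒜.parallelThrough_spec Y e.2.1
    obtain ⟨Z, hZ⟩ := 𝒜.exists_inter_eq h₁ h₄ fun h =>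
      hde (𝒜.direction_eq_of_parallel h₁ h₃ (𝒜.parallel_trans h₁ h₄ e.2.1 h h₆))
    obtain ⟨hZ₁, hZ₂⟩ : Z ∈ 𝒜.parallelThrough X d.1 ∩ 𝒜.parallelThrough Y e.1 := by rw [hZ]; rfl
    exact ⟨Z, ⟨_, h₁, h₃, h₂, hZ₁⟩, ⟨_, h₄, h₆, h₅, hZ₂⟩⟩
  exists_dir_ne := by
    intro d e
    obtain ⟨p, q, r, hpq, hpr, hqr, H⟩ := 𝒜.exists_triangle
    obtain ⟨a, m, hm, hma, hpm, hqm⟩ := 𝒜.exists_aligned O p q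
    obtain ⟨b, n, hn, hnb, hpn, hrn⟩ := 𝒜.exists_aligned O p r
    obtain ⟨c, k, hk, hkc, hqk, hrk⟩ := 𝒜.exists_aligned O q r
    have hab : a ≠ b := by
      rintro rfl
      have := (𝒜.parallel_trans hm a.2.1 hn hma hnb.symm).eq_of_mem hpm hpn
      exact H ⟨m, hm, hpm, hqm, this ▸ hrn⟩
    have hac : a ≠ c := by
      rintro rfl
      have := (𝒜.parallel_trans hm a.2.1 hk hma hkc.symm).eq_of_mem hqm hqk
      exact H ⟨m, hm, hpm, hqm, this ▸ hrk⟩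
    have hbc : b ≠ c := by
      rintro rfl
      have := (𝒜.parallel_trans hn b.2.1 hk hnb hkc.symm).eq_of_mem hrn hrk
      exact H ⟨n, hn, hpn, this ▸ hqk, hrn⟩
    -- The three sides of a triangle have three different directions, which cannot all be among `d`
    -- and `e`.
    by_contra! h
    by_cases ha : a = d
    · exact hbc ((h b fun k => hab (ha.trans k.symm)).trans
        (h c fun k => hac (ha.trans k.symm)).symm)
    · by_cases hb : b = d
      · exact hac ((h a ha).trans (h c fun k => hbc (hb.trans k.symm)).symm)
      · exact hab ((h a ha).trans (h b hb).symm)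
  exists_point_ne := by
    intro X
    obtain ⟨p, q, r, hpq, -⟩ := 𝒜.exists_triangle
    by_cases h : p = X
    · exact ⟨q, fun h' => hpq (h.trans h'.symm)⟩
    · exact ⟨p, h⟩

/-! ### Desargues' axiom in terms of directions -/

variable {𝒜}

/-- The form with directions still makes sense for coinciding points, where `line` is meaningless.
-/
theorem parallel_lines_iff {O A B A' B' : P} (h : A ≠ B) (h' : A' ≠ B') :
    (∀ e, (𝒜.directionPlane O).r e A B → (𝒜.directionPlane O).r e A' B') ↔
      Parallel (𝒜.line A B) (𝒜.line A' B') := by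
  obtain ⟨h₁, h₂, h₃⟩ := 𝒜.line_spec h
  obtain ⟨h₁', h₂', h₃'⟩ := 𝒜.line_spec h'
  constructor
  · intro H
    obtain ⟨d, hd⟩ := 𝒜.exists_direction_parallel O h₁
    have := H d ((𝒜.aligned_line_iff h).2 hd)
    exact 𝒜.parallel_trans h₁ d.2.1 h₁' hd ((𝒜.aligned_line_iff h').1 this).symm
  · intro H e he
    exact (𝒜.aligned_line_iff h').2
      (𝒜.parallel_trans h₁' h₁ e.2.1 H.symm ((𝒜.aligned_line_iff h).1 he))

open DirectionPlane in
-- The axiom requires every vertex to move; if one vertex is fixed, all are, and the claim is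
-- trivial.
theorem IsDesarguesian.minorDesargues (h𝒜 : 𝒜.IsDesarguesian) (O : P) :
    (𝒜.directionPlane O).MinorDesargues := by
  intro d A B C A' B' C' hAB hBC hAC hA hB hC h₁ h₂
  have fixed : ∀ {X X' Y Y' : P}, ¬ (𝒜.directionPlane O).r d X Y → (𝒜.directionPlane O).r d Y Y' →
      (∀ e, (𝒜.directionPlane O).r e X Y → (𝒜.directionPlane O).r e X' Y') → X = X' → Y = Y' := by
    rintro X X' Y Y' hXY hY H rfl
    obtain ⟨e, he⟩ := (𝒜.directionPlane O).exists_dir X Y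
    have hde : d ≠ e := fun h => hXY (h ▸ he)
    exact (𝒜.directionPlane O).eq_of hde hY (trans (symm he) (H e he))
  have ne : ∀ {X X' Y Y' : P}, ¬ (𝒜.directionPlane O).r d X Y → (𝒜.directionPlane O).r d X X' →
      (𝒜.directionPlane O).r d Y Y' → X' ≠ Y' := by
    rintro X X' Y Y' hXY hX hY rfl
    exact hXY (trans hX (symm hY))
  by_cases hAA : A = A'
  · have hBB := fixed hAB hB h₁ hAA
    have hCC := fixed hBC hC h₂ hBB
    subst hAA hCC
    exact fun e he => he
  have hBB : B ≠ B' := fun h => hAA <|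
    fixed (fun h' => hAB (symm h')) hA (fun e he => symm (h₁ e (symm he))) h
  have hCC : C ≠ C' := fun h => hBB <|
    fixed (fun h' => hBC (symm h')) hB (fun e he => symm (h₂ e (symm he))) h
  have neq : ∀ {X Y : P}, ¬ (𝒜.directionPlane O).r d X Y → X ≠ Y := fun h h' =>
    h (h' ▸ refl d _)
  have hdA := (𝒜.aligned_line_iff hAA).1 hA
  have hdB := (𝒜.aligned_line_iff hBB).1 hB
  have hdC := (𝒜.aligned_line_iff hCC).1 hC
  have sA := 𝒜.line_spec hAA
  have sB := 𝒜.line_spec hBB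
  have sC := 𝒜.line_spec hCC
  rw [parallel_lines_iff (neq hAC) (ne hAC hA hC)]
  rw [parallel_lines_iff (neq hAB) (ne hAB hA hB)] at h₁
  rw [parallel_lines_iff (neq hBC) (ne hBC hB hC)] at h₂
  exact h𝒜 A B C A' B' C' hAA hBB hCC (neq hAB) (neq hBC) (neq hAC) (ne hAB hA hB) (ne hBC hB hC)
    (ne hAC hA hC) (fun h => hAB ⟨_, sA.1, hdA, sA.2.1, h ▸ sB.2.1⟩)
    (fun h => hBC ⟨_, sB.1, hdB, sB.2.1, h ▸ sC.2.1⟩)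
    (fun h => hAC ⟨_, sA.1, hdA, sA.2.1, h ▸ sC.2.1⟩)
    (Or.inl ⟨𝒜.parallel_trans sA.1 d.2.1 sB.1 hdA hdB.symm,
      𝒜.parallel_trans sB.1 d.2.1 sC.1 hdB hdC.symm⟩) h₁ h₂

open DirectionPlane in
-- The degenerate cases propagate from vertex to vertex: one fixed vertex makes all fixed, and one
-- vertex sent to `S` sends all to `S`.
theorem IsDesarguesian.centralDesargues (h𝒜 : 𝒜.IsDesarguesian) (O : P) :
    (𝒜.directionPlane O).CentralDesargues := by
  intro S a b c A B C A' B' C' hab hbc hac hAS hBS hCS hA hA' hB hB' hC hC' h₁ h₂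
  have neq : ∀ {d e X Y}, d ≠ e → X ≠ S → (𝒜.directionPlane O).r d S X →
      (𝒜.directionPlane O).r e S Y → X ≠ Y := by
    rintro d e X Y hde hXS hX hY rfl
    exact hXS ((𝒜.directionPlane O).eq_of hde hX hY).symm
  have hdir : ∀ {d e f X Y}, d ≠ e → X ≠ S → (𝒜.directionPlane O).r d S X →
      (𝒜.directionPlane O).r e S Y → (𝒜.directionPlane O).r f X Y → e ≠ f := by
    rintro d e f X Y hde hXS hX hY hXY rfl
    exact hde (dir_unique hXS.symm hX (trans hY (symm hXY)))
  have fixed : ∀ {d e X X' Y Y'}, d ≠ e → X ≠ S → (𝒜.directionPlane O).r d S X →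
      (𝒜.directionPlane O).r e S Y → (𝒜.directionPlane O).r e S Y' →
      (∀ e, (𝒜.directionPlane O).r e X Y → (𝒜.directionPlane O).r e X' Y') → X = X' → Y = Y' := by
    rintro d e X X' Y Y' hde hXS hX hY hY' H rfl
    obtain ⟨f, hf⟩ := (𝒜.directionPlane O).exists_dir X Y
    exact (𝒜.directionPlane O).eq_of (hdir hde hXS hX hY hf) (trans (symm hY) hY')
      (trans (symm hf) (H f hf))
  have centre : ∀ {d e X X' Y Y'}, d ≠ e → X ≠ S → (𝒜.directionPlane O).r d S X →
      (𝒜.directionPlane O).r e S Y → (𝒜.directionPlane O).r e S Y' →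
      (∀ e, (𝒜.directionPlane O).r e X Y → (𝒜.directionPlane O).r e X' Y') → X' = S → Y' = S := by
    rintro d e X X' Y Y' hde hXS hX hY hY' H rfl
    obtain ⟨f, hf⟩ := (𝒜.directionPlane O).exists_dir X Y
    exact ((𝒜.directionPlane O).eq_of (hdir hde hXS hX hY hf) hY' (H f hf)).symm
  have h₁' : ∀ e, (𝒜.directionPlane O).r e B A → (𝒜.directionPlane O).r e B' A' :=
    fun e he => symm (h₁ e (symm he))
  have h₂' : ∀ e, (𝒜.directionPlane O).r e C B → (𝒜.directionPlane O).r e C' B' :=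
    fun e he => symm (h₂ e (symm he))
  by_cases hAA : A = A'
  · have hBB := fixed hab hAS hA hB hB' h₁ hAA
    have hCC := fixed hbc hBS hB hC hC' h₂ hBB
    subst hAA hCC
    exact fun e he => he
  by_cases hA'S : A' = S
  · have hB'S := centre hab hAS hA hB hB' h₁ hA'S
    have hC'S := centre hbc hBS hB hC hC' h₂ hB'S
    rw [hA'S, hC'S]
    exact fun e _ => refl e S
  have hBB : B ≠ B' := fun h => hAA <| fixed hab.symm hBS hB hA hA' h₁' h
  have hCC : C ≠ C' := fun h => hBB <| fixed hbc.symm hCS hC hB hB' h₂' h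
  have hB'S : B' ≠ S := fun h => hA'S <| centre hab.symm hBS hB hA hA' h₁' h
  have sA := 𝒜.line_spec hAA
  have sB := 𝒜.line_spec hBB
  have sC := 𝒜.line_spec hCC
  have pA := (𝒜.aligned_line_iff hAA).1 ((𝒜.directionPlane O).equiv a |>.trans (symm hA) hA')
  have pB := (𝒜.aligned_line_iff hBB).1 ((𝒜.directionPlane O).equiv b |>.trans (symm hB) hB')
  have pC := (𝒜.aligned_line_iff hCC).1 ((𝒜.directionPlane O).equiv c |>.trans (symm hC) hC')
  have mem : ∀ {d : 𝒜.Direction O} {X : P} {l : Set P}, l ∈ 𝒜.lines → X ∈ l → Parallel l d.1 →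
      (𝒜.directionPlane O).r d S X → S ∈ l := by
    rintro d X l hl hX hld ⟨m, hm, hmd, hSm, hXm⟩
    exact (𝒜.parallel_trans hm d.2.1 hl hmd hld.symm).eq_of_mem hXm hX ▸ hSm
  have nAB := neq hab hAS hA hB
  have nBC := neq hbc hBS hB hC
  have nAC := neq hac hAS hA hC
  have nAB' := neq hab hA'S hA' hB'
  have nBC' := neq hbc hB'S hB' hC'
  have nAC' := neq hac hA'S hA' hC'
  rw [parallel_lines_iff nAC nAC']
  rw [parallel_lines_iff nAB nAB'] at h₁
  rw [parallel_lines_iff nBC nBC'] at h₂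
  exact h𝒜 A B C A' B' C' hAA hBB hCC nAB nBC nAC nAB' nBC' nAC'
    (fun h => hab (𝒜.direction_eq_of_parallel sA.1 pA (h ▸ pB)))
    (fun h => hbc (𝒜.direction_eq_of_parallel sB.1 pB (h ▸ pC)))
    (fun h => hac (𝒜.direction_eq_of_parallel sA.1 pA (h ▸ pC)))
    (Or.inr ⟨S, mem sA.1 sA.2.1 pA hA, mem sB.1 sB.2.1 pB hB, mem sC.1 sC.2.1 pC hC⟩) h₁ h₂

/-! ### The algorithms as values of dilatations -/

theorem aligned_of_mem_parallelThrough {O X Y Z W : P} (h : Y ≠ Z)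
    (hW : W ∈ 𝒜.parallelThrough X (𝒜.line Y Z)) {d : 𝒜.Direction O}
    (hd : (𝒜.directionPlane O).r d Y Z) : (𝒜.directionPlane O).r d X W := by
  obtain ⟨h₁, -, -⟩ := 𝒜.line_spec h
  obtain ⟨h₄, h₅, h₆⟩ := 𝒜.parallelThrough_spec X h₁
  exact ⟨_, h₄, 𝒜.parallel_trans h₄ h₁ d.2.1 h₆ ((𝒜.aligned_line_iff h).1 hd), h₅, hW⟩

/-- The direction of the line `OI`. -/
noncomputable def baseDirection {O I : P} (h : O ≠ I) : 𝒜.Direction O :=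
  ⟨𝒜.line O I, (𝒜.line_spec h).1, (𝒜.line_spec h).2.1⟩

theorem aligned_baseDirection {O I : P} (h : O ≠ I) {X Y : P} (hX : X ∈ 𝒜.line O I) :
    (𝒜.directionPlane O).r (baseDirection h) X Y ↔ Y ∈ 𝒜.line O I := by
  refine ⟨?_, fun hY => ⟨_, (𝒜.line_spec h).1, Or.inl rfl, hX, hY⟩⟩
  rintro ⟨m, hm, hml, hXm, hYm⟩
  have : m = 𝒜.line O I := hml.eq_of_mem hXm hX
  exact this ▸ hYm

open DirectionPlane in
-- This is the last step of both algorithms: `f` maps `BB₁` into its parallel through `f B₁`, which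
-- meets `OI` only at `f B`.
theorem eq_apply_of_parallel {O I : P} (h : O ≠ I) {B B₁ C : P} (hB : B ∈ 𝒜.line O I)
    (hB₁ : B₁ ∉ 𝒜.line O I) {f : P → P} (hf : (𝒜.directionPlane O).IsDilatation f)
    (hfB : f B ∈ 𝒜.line O I) (hC : C ∈ 𝒜.parallelThrough (f B₁) (𝒜.line B B₁))
    (hC' : C ∈ 𝒜.line O I) : C = f B := by
  have hne : B ≠ B₁ := fun e => hB₁ (e ▸ hB)
  obtain ⟨d, hd⟩ := (𝒜.directionPlane O).exists_dir B B₁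
  have hde : baseDirection h ≠ d := by
    rintro rfl
    exact hB₁ ((aligned_baseDirection h hB).1 hd)
  exact (𝒜.directionPlane O).eq_of hde ((aligned_baseDirection h hC').2 hfB)
    (trans (symm (aligned_of_mem_parallelThrough hne hC hd)) (symm (hf d _ _ hd)))

open DirectionPlane in
-- The point `P₁` is `f B₁`: it lies on the trace of `B₁` and on the parallel to `OB₁` through `f O
-- = A`.
theorem IsSum.eq_apply {O I A B C : P} (h : O ≠ I) (hB : B ∈ 𝒜.line O I)
    (hC : 𝒜.IsSum O I A B C) {f : P → P} (hf : (𝒜.directionPlane O).IsDilatation f)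
    (htr : ∀ X, (𝒜.directionPlane O).r (baseDirection h) X (f X)) (hfO : f O = A) : C = f B := by
  obtain ⟨B₁, hB₁, P₁, h₁, h₂⟩ := hC
  obtain ⟨hP₁, hP₁'⟩ : P₁ ∈ _ ∩ _ := h₁ ▸ Set.mem_singleton P₁
  obtain ⟨hC, hC'⟩ : C ∈ _ ∩ _ := h₂ ▸ Set.mem_singleton C
  have hO := (𝒜.line_spec h).2.1
  have hOB₁ : O ≠ B₁ := fun e => hB₁ (e ▸ hO)
  obtain ⟨d, hd⟩ := (𝒜.directionPlane O).exists_dir O B₁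
  have hde : baseDirection h ≠ d := by
    rintro rfl
    exact hB₁ ((aligned_baseDirection h hO).1 hd)
  have hP : P₁ = f B₁ := by
    have k₁ := aligned_of_mem_parallelThrough h hP₁
      ((aligned_baseDirection h hO).2 (𝒜.line_spec h).2.2)
    have k₂ := aligned_of_mem_parallelThrough hOB₁ hP₁' hd
    have k₃ := hf d _ _ hd
    rw [hfO] at k₃
    exact (𝒜.directionPlane O).eq_of hde (trans (symm k₁) (htr B₁)) (trans (symm k₂) k₃)
  subst hP
  exact eq_apply_of_parallel h hB hB₁ hf ((aligned_baseDirection h hB).1 (htr B)) hC hC'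

open DirectionPlane in
-- The point `P₁` is `f B₁`: it lies on `OB₁`, which `f` preserves, and on the parallel to `IB₁`
-- through `f I = A`.
theorem IsProd.eq_apply {O I A B C : P} (h : O ≠ I) (hB : B ∈ 𝒜.line O I)
    (hC : 𝒜.IsProd O I A B C) {f : P → P} (hf : (𝒜.directionPlane O).IsDilatation f)
    (hfO : f O = O) (hfI : f I = A) : C = f B := by
  obtain ⟨B₁, hB₁, P₁, h₁, h₂⟩ := hC
  obtain ⟨hP₁, hP₁'⟩ : P₁ ∈ _ ∩ _ := h₁ ▸ Set.mem_singleton P₁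
  obtain ⟨hC, hC'⟩ : C ∈ _ ∩ _ := h₂ ▸ Set.mem_singleton C
  obtain ⟨-, hO, hI⟩ := 𝒜.line_spec h
  have hOB₁ : O ≠ B₁ := fun e => hB₁ (e ▸ hO)
  have hIB₁ : I ≠ B₁ := fun e => hB₁ (e ▸ hI)
  obtain ⟨d, hd⟩ := (𝒜.directionPlane O).exists_dir O B₁
  obtain ⟨e, he⟩ := (𝒜.directionPlane O).exists_dir I B₁
  have hde : d ≠ e := by
    rintro rfl
    have k₁ := dir_unique h ((aligned_baseDirection h hO).2 hI) (trans hd (symm he))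
    exact hB₁ ((aligned_baseDirection h hO).1 (k₁ ▸ hd))
  have hP : P₁ = f B₁ := by
    have k₁ := aligned_of_mem_parallelThrough hIB₁ hP₁ he
    have k₂ : (𝒜.directionPlane O).r d O P₁ :=
      ⟨_, (𝒜.line_spec hOB₁).1, (𝒜.aligned_line_iff hOB₁).1 hd, (𝒜.line_spec hOB₁).2.1, hP₁'⟩
    have k₃ := hf d _ _ hd
    have k₄ := hf e _ _ he
    rw [hfO] at k₃
    rw [hfI] at k₄
    exact (𝒜.directionPlane O).eq_of hde (trans (symm k₂) k₃) (trans (symm k₁) k₄)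
  subst hP
  have hfB := hf (baseDirection h) _ _ ((aligned_baseDirection h hO).2 hB)
  rw [hfO] at hfB
  exact eq_apply_of_parallel h hB hB₁ hf ((aligned_baseDirection h hO).1 hfB) hC hC'

/-! ### Arithmetic on `OI` and the distributive laws -/

namespace LinePoint

variable {O I : P} {h : O ≠ I}

theorem val_add_eq (x y : 𝒜.LinePoint h) {f : P → P}
    (hf : (𝒜.directionPlane O).IsDilatation f)
    (htr : ∀ X, (𝒜.directionPlane O).r (baseDirection h) X (f X)) (hfO : f O = x.1) :
    (x + y).1 = f y.1 :=
  (𝒜.exists_isSum h (A := x.1) y.2).choose_spec.2.eq_apply h y.2 hf htr hfO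

theorem val_mul_eq (x y : 𝒜.LinePoint h) {f : P → P}
    (hf : (𝒜.directionPlane O).IsDilatation f) (hfO : f O = O) (hfI : f I = x.1) :
    (x * y).1 = f y.1 :=
  (𝒜.exists_isProd h (A := x.1) y.2).choose_spec.2.eq_apply h y.2 hf hfO hfI

theorem exists_mul_eq (h𝒜 : 𝒜.IsDesarguesian) (x : 𝒜.LinePoint h) :
    ∃ f : P → P, (𝒜.directionPlane O).IsDilatation f ∧ f O = O ∧ f I = x.1 ∧
      ∀ y : 𝒜.LinePoint h, (x * y).1 = f y.1 := by
  obtain ⟨-, hO, hI⟩ := 𝒜.line_spec h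
  obtain ⟨f, hf, hfO, hfI⟩ := DirectionPlane.exists_homothety (h𝒜.centralDesargues O) h.symm
    ((aligned_baseDirection h hO).2 hI) ((aligned_baseDirection h hO).2 x.2)
  exact ⟨f, hf, hfO, hfI, fun y => val_mul_eq x y hf hfO hfI⟩

theorem zero_add (x : 𝒜.LinePoint h) : 0 + x = x :=
  Subtype.ext (val_add_eq 0 x DirectionPlane.isDilatation_id
    (fun X => DirectionPlane.refl _ X) rfl)

theorem one_mul (x : 𝒜.LinePoint h) : 1 * x = x :=
  Subtype.ext (val_mul_eq 1 x DirectionPlane.isDilatation_id rfl rfl)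

theorem mul_one (h𝒜 : 𝒜.IsDesarguesian) (x : 𝒜.LinePoint h) : x * 1 = x := by
  obtain ⟨f, -, -, hfI, hf⟩ := exists_mul_eq h𝒜 x
  exact Subtype.ext ((hf 1).trans hfI)

theorem mul_zero (h𝒜 : 𝒜.IsDesarguesian) (x : 𝒜.LinePoint h) : x * 0 = 0 := by
  obtain ⟨f, -, hfO, -, hf⟩ := exists_mul_eq h𝒜 x
  exact Subtype.ext ((hf 0).trans hfO)

theorem zero_mul (h𝒜 : 𝒜.IsDesarguesian) (x : 𝒜.LinePoint h) : 0 * x = 0 := by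
  obtain ⟨f, hf, hfO, hfI, hfx⟩ := exists_mul_eq h𝒜 (0 : 𝒜.LinePoint h)
  obtain ⟨-, hO, hI⟩ := 𝒜.line_spec h
  -- Constant maps count as dilatations, so agreement at `O` and `I` makes `f` constant.
  have hc : f = fun _ => O := hf.ext (fun d _ _ _ => DirectionPlane.refl d O) h hfO hfI
  exact Subtype.ext ((hfx x).trans (congrFun hc x.1))

/-- The distributive laws hold for all points of the line `OI`. -/
theorem distrib (h𝒜 : 𝒜.IsDesarguesian) (x y z : 𝒜.LinePoint h) :
    x * (y + z) = x * y + x * z ∧ (x + y) * z = x * z + y * z := by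
  obtain ⟨-, hO, hI⟩ := 𝒜.line_spec h
  -- On a two-point line there is no third parallel from which to glue translations, so this case is
  -- separate.
  by_cases htwo : ∀ w : 𝒜.LinePoint h, w = 0 ∨ w = 1
  · constructor
    · rcases htwo x with rfl | rfl
      · simp only [zero_mul h𝒜, zero_add]
      · simp only [one_mul]
    · rcases htwo z with rfl | rfl
      · simp only [mul_zero h𝒜, zero_add]
      · simp only [mul_one h𝒜]
  push Not at htwo
  obtain ⟨w, hw₀, hw₁⟩ := htwo
  have third := (𝒜.directionPlane O).exists_off_two (d := baseDirection h) h
    (Z := w.1) (fun e => hw₀ (Subtype.ext e.symm)) (fun e => hw₁ (Subtype.ext e.symm))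
    ((aligned_baseDirection h hO).2 hI) ((aligned_baseDirection h hO).2 w.2)
  have hN := h𝒜.minorDesargues O
  obtain ⟨t, ht⟩ := DirectionPlane.exists_isTranslationFamily hN third O
  have hadd : ∀ a b : 𝒜.LinePoint h, (a + b).1 = t a.1 b.1 := fun a b =>
    val_add_eq a b (ht.isDilatation _) (ht.trace ((aligned_baseDirection h hO).2 a.2))
      (ht.apply_origin _)
  obtain ⟨f, hf, hfO, hfI, hfx⟩ := exists_mul_eq h𝒜 x
  obtain ⟨g, hg, hgO, hgI, hgy⟩ := exists_mul_eq h𝒜 y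
  constructor <;> apply Subtype.ext
  · rw [hfx, hadd, hadd, hfx, hfx, ht.map_apply hf hfO]
  -- The pointwise sum of `f` and `g` serves as the dilatation that computes multiplication by `x +
  -- y`.
  · rw [val_mul_eq (x + y) z (ht.isDilatation_add hN third hf hg hfO hgO)
      (by rw [hfO, hgO, ht.apply_origin]) (by rw [hfI, hgI, hadd]), hadd, hfx, hgy]

end LinePoint

end AffinePlane

theorem theorem2p3 {P : Type*} (𝒜 : AffinePlane P) (h𝒜 : 𝒜.IsDesarguesian)
    {O I : P} (h : O ≠ I) (B C D : 𝒜.LinePoint h) (hBC : B ≠ C) :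
    ∀ x ∈ AffinePlane.LinePoint.mobiusPoints B C D,
    ∀ y ∈ AffinePlane.LinePoint.mobiusPoints B C D,
    ∀ z ∈ AffinePlane.LinePoint.mobiusPoints B C D,
      x * (y + z) = x * y + x * z ∧ (x + y) * z = x * z + y * z :=
  fun x _ y _ z _ => AffinePlane.LinePoint.distrib h𝒜 x y z
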